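/- **Theorem 6.4.** Let $\mathbb K$ be a (commutative) field and let $(X,d)$ be a non-empty locally finite extended metric space, i.e. $d\colon X\times X\to[0,\infty]$ is a metric that may take the value $\infty$, and every subset of $X$ of finite diameter is finite. For $R>0$ and $A\subseteq X$ put $\partial_R A=\{x\in X: d(x,A)\le R \text{ and } d(x,X\setminus A)\le R\}$, where $d(x,\emptyset)=\infty$. Call $X$ *properly amenable* if for all $R>0$, $\varepsilon>0$ and every finite $A\subseteq X$ there is a finite non-empty $F\subseteq X$ with $A\subseteq F$ and $|\partial_R F|\le\varepsilon|F|$. A *partial translation* of $X$ is a bijection $t\colon A\to B$ between subsets $A,B\subseteq X$ with $\sup_{x\in A}d(x,t(x))<\infty$. Let $\mathbb K[X]$ be the $\mathbb K$-vector space with basis $(\delta_x)_{x\in X}$, and let $V_t\in\mathrm{End}_{\mathbb K}(\mathbb K[X])$ be given by $V_t\delta_x=\delta_{t(x)}$ if $x\in A$ and $V_t\delta_x=0$ otherwise. The *translation algebra* $\mathbb K_{\mathrm u}(X)$ is the unital $\mathbb K$-subalgebra of $\mathrm{End}_{\mathbb K}(\mathbb K[X])$ generated by all the operators $V_t$. A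 $\mathbb K$-algebra $\mathcal A$ is *properly (left) algebraically amenable* if for every $\varepsilon>0$ and every finite $\mathcal F\subseteq\mathcal A$ there is a non-zero finite-dimensional linear subspace $W\subseteq\mathcal A$ with $\mathcal F\subseteq W$ and $\dim(aW+W)\le(1+\varepsilon)\dim W$ for all $a\in\mathcal F$. A non-zero unital algebra $\mathcal B$ is *properly infinite* if there are orthogonal idempotents $e_1,e_2\in\mathcal B$ with $e_1\sim 1\sim e_2$, where $e\sim f$ means that $e=xy$ and $f=yx$ for some $x,y\in\mathcal B$. An algebra $\mathcal A$ is a *finite-dimensional extension* of $\mathcal B$ if $\mathcal A/I\cong\mathcal B$ as $\mathbb K$-algebras for some two-sided ideal $I$ of $\mathcal A$ of finite $\mathbb K$-dimension. Then the following conditions are equivalent: 1. $(X,d)$ is properly amenable. 2. $\mathbb K_{\mathrm u}(X)$ is properly algebraically amenable. 3. $\mathbb K_{\mathrm u}(X)$ is not a finite-dimensional extension of a properly infinite $\mathbb K$-algebra. -/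

import Mathlib

universe u v

namespace CoarseAmenability

open scoped ENNReal

noncomputable section

/-! ### Locally finite extended metric spaces and their Følner sets -/

section Metric

variable {X : Type*} [EMetricSpace X]

variable (X) in
/-- An extended metric space is locally finite if every bounded subset, that is, every subset of
finite diameter, is finite. -/
def IsLocallyFinite : Prop :=
  ∀ s : Set X, Metric.ediam s < ∞ → s.Finite

/-- The `R`-boundary of `A`: the points at distance at most `R` both from `A` and from the
complement of `A`. The distance to the empty set is `∞`. -/
def rBoundary (R : ℝ) (A : Set X) : Set X :=
  {x | Metric.infEDist x A ≤ ENNReal.ofReal R ∧ Metric.infEDist x Aᶜ ≤ ENNReal.ofReal R}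

/-- A finite non-empty set `F` is an `(R, ε)`-Følner set if `|∂_R F| / |F| ≤ ε`. (In a locally
finite space the boundary of a finite set is automatically finite.) -/
def IsFolnerSet (R ε : ℝ) (F : Finset X) : Prop :=
  F.Nonempty ∧ (rBoundary R (F : Set X)).Finite ∧
    ((rBoundary R (F : Set X)).ncard : ℝ) / (F.card : ℝ) ≤ ε

variable (X) in
/-- Proper amenability: for all `R > 0`, `ε > 0`, every finite set is contained in an
`(R, ε)`-Følner set. -/
def IsProperlyAmenable : Prop :=
  ∀ R : ℝ, 0 < R → ∀ ε : ℝ, 0 < ε → ∀ A : Finset X, ∃ F : Finset X, IsFolnerSet R ε F ∧ A ⊆ F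

end Metric

/-! ### Partial translations and the translation algebra -/

/-- A partial translation: a bijection between two subsets of `X` whose graph is controlled. -/
structure PartialTranslation (X : Type*) [EMetricSpace X] where
  /-- the domain -/
  dom : Set X
  /-- the range -/
  ran : Set X
  /-- the bijection -/
  toEquiv : dom ≃ ran
  controlled : ⨆ x : dom, edist (x : X) (toEquiv x : X) < ∞

section TranslationAlgebra

variable (K : Type*) [Field K] {X : Type*} [EMetricSpace X]

open Classical in
/-- The operator `V_t` on the free vector space `K[X]`, with `V_t δ_x = δ_{t(x)}` for `x` in the
domain of `t` and `V_t δ_x = 0` otherwise. -/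
def PartialTranslation.operator (t : PartialTranslation X) : Module.End K (X →₀ K) :=
  Finsupp.linearCombination K fun x : X =>
    if h : x ∈ t.dom then Finsupp.single (t.toEquiv ⟨x, h⟩ : X) (1 : K) else 0

variable (X) in
/-- The translation algebra: the unital subalgebra of `End_K(K[X])` generated by the operators of
all partial translations. -/
def translationAlgebra : Subalgebra K (Module.End K (X →₀ K)) :=
  Algebra.adjoin K (Set.range fun t : PartialTranslation X => t.operator K)

/-- The usual ring structure of a subalgebra of `End_K(K[X])`; it has to be spelled out because
instance search does not find it. -/
instance translationAlgebra.instRing : Ring (translationAlgebra K X) :=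
  @Subalgebra.toRing K (Module.End K (X →₀ K)) _ Module.End.instRing _ (translationAlgebra K X)

end TranslationAlgebra

/-! ### Algebraic amenability, proper infiniteness, finite-dimensional extensions -/

section Algebra

variable (K : Type*) [Field K] (A : Type*) [Ring A] [Algebra K A]

variable {A} in
/-- A non-zero finite-dimensional subspace `W` is a left `(S, ε)`-Følner subspace if
`dim (a W + W) / dim W ≤ 1 + ε` for all `a ∈ S`. -/
def IsFolnerSubspace (S : Finset A) (ε : ℝ) (W : Submodule K A) : Prop :=
  W ≠ ⊥ ∧ FiniteDimensional K W ∧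
    ∀ a ∈ S, (Module.finrank K ↥(W.map (LinearMap.mulLeft K a) ⊔ W) : ℝ) /
      (Module.finrank K W : ℝ) ≤ 1 + ε

/-- Proper (left) algebraic amenability: for every `ε > 0`, every finite set `S` is contained in
a left `(S, ε)`-Følner subspace. -/
def IsProperlyAlgebraicallyAmenable : Prop :=
  ∀ ε : ℝ, 0 < ε → ∀ S : Finset A, ∃ W : Submodule K A,
    IsFolnerSubspace K S ε W ∧ (S : Set A) ⊆ W

/-- Murray–von Neumann equivalence of idempotents: `e = x y` and `f = y x`. -/
def MvNEquiv {B : Type*} [Ring B] (e f : B) : Prop :=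
  ∃ x y : B, e = x * y ∧ f = y * x

/-- An idempotent `e` is properly infinite if there are orthogonal idempotents `e₁, e₂ ∈ e B e`,
each Murray–von Neumann equivalent to `e`. -/
def IsProperlyInfiniteIdempotent {B : Type*} [Ring B] (e : B) : Prop :=
  IsIdempotentElem e ∧ ∃ e₁ e₂ : B,
    (∃ b : B, e₁ = e * b * e) ∧ (∃ b : B, e₂ = e * b * e) ∧
    IsIdempotentElem e₁ ∧ IsIdempotentElem e₂ ∧ e₁ * e₂ = 0 ∧ e₂ * e₁ = 0 ∧
    MvNEquiv e₁ e ∧ MvNEquiv e e₂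

/-- A non-zero unital algebra is properly infinite if its unit is a properly infinite
idempotent. -/
def IsProperlyInfinite (B : Type*) [Ring B] : Prop :=
  Nontrivial B ∧ IsProperlyInfiniteIdempotent (1 : B)

/-- `A` is a finite-dimensional extension of `B` if `A / I ≅ B` as `K`-algebras for some
two-sided ideal `I` of `A` of finite `K`-dimension. -/
def IsFiniteDimensionalExtension (B : Type*) [Ring B] [Algebra K B] : Prop :=
  ∃ (I : Ideal A) (_ : I.IsTwoSided),
    FiniteDimensional K ↥(I.restrictScalars K) ∧ Nonempty ((A ⧸ I) ≃ₐ[K] B)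

end Algebra

end

end CoarseAmenability

namespace CoarseAmenability

open scoped ENNReal NNReal

noncomputable section

/-! ### Expansion and paradoxicality when proper amenability fails -/

section MetricLemmas

variable {X : Type*} [EMetricSpace X]

/-! Amenable space to amenable algebra: choosing a base point in each coarse component embeds `K[X]`
as a left ideal of the translation algebra (`mul_columnEmbedding`), so a Følner set `F` yields an
almost invariant subspace of dimension `|F|`. Adjoining the span of the prescribed operators costs
boundedly many dimensions, negligible once `F` is forced to be large. If `X` is finite, the whole
algebra serves.

Amenable algebra to no properly infinite quotient by a finite-dimensional ideal: two isometries with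
orthogonal ranges double dimensions (`two_mul_finrank_le`), while their lifts barely enlarge a
Følner subspace; the kernel of the quotient map hides only a bounded discrepancy.

Conversely, without proper amenability all large finite sets expand by any prescribed factor. Hence
all but finitely many points lie in the union `Y` of the infinite components, and every finite
subset of `Y` doubles. Hall's theorem gives an injection `Y × Bool → X` of bounded displacement,
that is, two partial translations of `Y` with disjoint ranges. Modulo the finite-dimensional ideal
of operators vanishing on `Y`, they are isometries with orthogonal ranges
(`isProperlyInfinite_quotient`). -/

theorem IsLocallyFinite.finite_closedEBall (hX : IsLocallyFinite X) (r : ℝ≥0) (x : X) :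
    (Metric.closedEBall x (r : ℝ≥0∞)).Finite :=
  hX _ (Metric.ediam_closedEBall_le.trans_lt (ENNReal.mul_lt_top (by simp) (by simp)))

/-- The closed ball of radius `r` as a finite set. -/
def IsLocallyFinite.ball (hX : IsLocallyFinite X) (r : ℝ≥0) (x : X) : Finset X :=
  (hX.finite_closedEBall r x).toFinset

theorem IsLocallyFinite.mem_ball (hX : IsLocallyFinite X) {r : ℝ≥0} {x z : X} :
    z ∈ hX.ball r x ↔ edist z x ≤ r := by
  simp [IsLocallyFinite.ball]

open Classical in
/-- The closed `r`-neighbourhood of a finite set. -/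
def IsLocallyFinite.thicken (hX : IsLocallyFinite X) (r : ℝ≥0) (F : Finset X) : Finset X :=
  F.biUnion (hX.ball r)

theorem IsLocallyFinite.mem_thicken (hX : IsLocallyFinite X) {r : ℝ≥0} {F : Finset X} {z : X} :
    z ∈ hX.thicken r F ↔ ∃ x ∈ F, edist z x ≤ r := by
  simp [IsLocallyFinite.thicken, hX.mem_ball]

theorem IsLocallyFinite.subset_thicken (hX : IsLocallyFinite X) (r : ℝ≥0) (F : Finset X) :
    F ⊆ hX.thicken r F := fun x hx => hX.mem_thicken.2 ⟨x, hx, by simp⟩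

theorem IsLocallyFinite.thicken_thicken_subset (hX : IsLocallyFinite X) (r s : ℝ≥0)
    (F : Finset X) : hX.thicken r (hX.thicken s F) ⊆ hX.thicken (r + s) F := by
  intro z hz
  obtain ⟨y, hy, hzy⟩ := hX.mem_thicken.1 hz
  obtain ⟨x, hx, hyx⟩ := hX.mem_thicken.1 hy
  refine hX.mem_thicken.2 ⟨x, hx, (edist_triangle z y x).trans ?_⟩
  push_cast
  exact add_le_add hzy hyx

/-- Only finitely many points of `s` lie within `r + 1` of `x`, so the infimum is attained. -/
theorem IsLocallyFinite.exists_edist_le_of_infEDist_le (hX : IsLocallyFinite X) {r : ℝ≥0} {x : X}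
    {s : Set X} (h : Metric.infEDist x s ≤ r) : ∃ y ∈ s, edist x y ≤ r := by
  by_contra! hs
  have hfin : (s ∩ Metric.closedEBall x ((r + 1 : ℝ≥0) : ℝ≥0∞)).Finite :=
    (hX.finite_closedEBall _ x).subset Set.inter_subset_right
  have hlt : (r : ℝ≥0∞) < (r + 1 : ℝ≥0) := by
    exact_mod_cast lt_add_one r
  obtain ⟨y, hy, hyr⟩ := Metric.infEDist_lt_iff.1 (h.trans_lt hlt)
  obtain ⟨z, hz, hmin⟩ := Set.exists_min_image _ (fun y => edist x y) hfin
    ⟨y, hy, by rw [Metric.mem_closedEBall, edist_comm]; exact hyr.le⟩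
  have : min (edist x z) ((r + 1 : ℝ≥0) : ℝ≥0∞) ≤ Metric.infEDist x s := by
    refine Metric.le_infEDist.2 fun w hw => ?_
    by_cases hwr : edist x w ≤ ((r + 1 : ℝ≥0) : ℝ≥0∞)
    · exact (min_le_left _ _).trans
        (hmin w ⟨hw, by rw [Metric.mem_closedEBall, edist_comm]; exact hwr⟩)
    · exact (min_le_right _ _).trans (not_le.1 hwr).le
  exact (lt_min (hs z hz.1) hlt).not_ge (this.trans h)

/-- The `r`-ball around a point of `F` stays inside the thickening, so points of `F` are not in its
boundary. A large boundary thus becomes growth of `F` under thickening twice. -/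
theorem IsLocallyFinite.rBoundary_thicken_subset (hX : IsLocallyFinite X) (r : ℝ≥0)
    (F : Finset X) [DecidableEq X] :
    rBoundary (r : ℝ) (hX.thicken r F : Set X) ⊆
      (hX.thicken r (hX.thicken r F) \ F : Finset X) := by
  rintro x ⟨h₁, h₂⟩
  rw [ENNReal.ofReal_coe_nnreal] at h₁ h₂
  obtain ⟨y, hy, hxy⟩ := hX.exists_edist_le_of_infEDist_le h₁
  obtain ⟨z, hz, hxz⟩ := hX.exists_edist_le_of_infEDist_le h₂
  simp only [Finset.coe_sdiff, Set.mem_sdiff, Finset.mem_coe]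
  refine ⟨hX.mem_thicken.2 ⟨y, hy, hxy⟩, fun hx => hz ?_⟩
  exact hX.mem_thicken.2 ⟨x, hx, by rwa [edist_comm]⟩

theorem mem_rBoundary_of_edist_le {r : ℝ≥0} {F : Set X} {x z : X} (hx : x ∈ F) (hz : z ∉ F)
    (h : edist z x ≤ r) : z ∈ rBoundary (r : ℝ) F := by
  refine ⟨?_, ?_⟩
  · rw [ENNReal.ofReal_coe_nnreal]
    exact (Metric.infEDist_le_edist_of_mem hx).trans h
  · rw [Metric.infEDist_zero_of_mem (show z ∈ Fᶜ from hz)]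
    exact zero_le

/-- Failure of proper amenability makes all large finite sets expand. -/
theorem IsLocallyFinite.exists_expansion (hX : IsLocallyFinite X)
    (h : ¬ IsProperlyAmenable X) :
    ∃ r : ℝ≥0, ∃ ε : ℝ, 0 < ε ∧ ∃ N : ℕ, ∀ F : Finset X, N < F.card →
      (1 + ε) * F.card ≤ (hX.thicken r F).card := by
  classical
  simp only [IsProperlyAmenable, not_forall] at h
  obtain ⟨R, hR, ε, hε, A, hA⟩ := h
  lift R to ℝ≥0 using hR.le
  set C := (hX.thicken R (hX.thicken R A)).card
  -- No Følner set contains `A`, so the argument runs on `F ∪ A`. Discarding `A` afterwards loses at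
  -- most `C` points, which half of `ε` absorbs once `2 * C ≤ ε * |F|`.
  refine ⟨R + R, ε / 2, by positivity, ⌈2 * C / ε⌉₊, fun F hF => ?_⟩
  have hFC : 2 * (C : ℝ) ≤ ε * F.card := by
    have := (Nat.le_ceil _).trans (Nat.cast_le (α := ℝ).2 hF.le)
    rw [div_le_iff₀ hε] at this
    linarith
  have hF0 : F.Nonempty := Finset.card_pos.1 (by omega)
  set T := fun F : Finset X => hX.thicken R (hX.thicken R F)
  set G := hX.thicken R (F ∪ A)
  have hsub := hX.rBoundary_thicken_subset R (F ∪ A)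
  have hFG : F ∪ A ⊆ G := hX.subset_thicken _ _
  have hfin : (rBoundary (R : ℝ) (G : Set X)).Finite := (Finset.finite_toSet _).subset hsub
  have hG0 : G.Nonempty := (hF0.mono Finset.subset_union_left).mono hFG
  have hbd : ε * G.card < (rBoundary (R : ℝ) (G : Set X)).ncard := by
    by_contra! hle
    refine hA ⟨G, ⟨hG0, hfin, ?_⟩, Finset.subset_union_right.trans hFG⟩
    rwa [div_le_iff₀ (by exact_mod_cast hG0.card_pos)]
  have h₁ : (rBoundary (R : ℝ) (G : Set X)).ncard + (F ∪ A).card ≤ (T (F ∪ A)).card := by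
    have := Set.ncard_le_ncard hsub (Finset.finite_toSet _)
    rw [Set.ncard_coe_finset, Finset.card_sdiff_of_subset
      (hFG.trans (hX.subset_thicken _ _))] at this
    have h := Finset.card_le_card (hFG.trans (hX.subset_thicken R G))
    exact (Nat.le_sub_iff_add_le h).1 this
  have h₂ : (T (F ∪ A)).card ≤ (T F).card + C := by
    refine le_trans (Finset.card_le_card ?_) (Finset.card_union_le _ _)
    intro z hz
    obtain ⟨y, hy, hzy⟩ := hX.mem_thicken.1 hz
    obtain ⟨x, hx, hyx⟩ := hX.mem_thicken.1 hy
    rcases Finset.mem_union.1 hx with hx | hx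
    · exact Finset.mem_union_left _
        (hX.mem_thicken.2 ⟨y, hX.mem_thicken.2 ⟨x, hx, hyx⟩, hzy⟩)
    · exact Finset.mem_union_right _
        (hX.mem_thicken.2 ⟨y, hX.mem_thicken.2 ⟨x, hx, hyx⟩, hzy⟩)
  have h₃ : (T F).card ≤ (hX.thicken (R + R) F).card :=
    Finset.card_le_card (hX.thicken_thicken_subset R R F)
  have h₄ : F.card ≤ (F ∪ A).card := Finset.card_le_card Finset.subset_union_left
  have h₅ : (F ∪ A).card ≤ G.card := Finset.card_le_card hFG
  have h₆ : ε * F.card ≤ ε * G.card :=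
    mul_le_mul_of_nonneg_left (by exact_mod_cast h₄.trans h₅) hε.le
  have h₇ : ((rBoundary (R : ℝ) (G : Set X)).ncard : ℝ) + F.card ≤
      (hX.thicken (R + R) F).card + C := by
    exact_mod_cast (by omega)
  linarith

theorem IsLocallyFinite.exists_large_expansion (hX : IsLocallyFinite X)
    (h : ¬ IsProperlyAmenable X) :
    ∃ N : ℕ, ∀ C : ℕ, ∃ r : ℝ≥0, ∀ F : Finset X, N < F.card →
      C * F.card ≤ (hX.thicken r F).card := by
  obtain ⟨r, ε, hε, N, hN⟩ := hX.exists_expansion h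
  have key : ∀ k : ℕ, ∃ s : ℝ≥0, ∀ F : Finset X, N < F.card →
      (1 + ε) ^ k * F.card ≤ (hX.thicken s F).card := by
    intro k
    induction k with
    | zero =>
      refine ⟨0, fun F _ => ?_⟩
      simpa using Finset.card_le_card (hX.subset_thicken 0 F)
    | succ k ih =>
      obtain ⟨s, hs⟩ := ih
      refine ⟨r + s, fun F hF => ?_⟩
      have h₁ := hs F hF
      have h₂ := hN (hX.thicken s F)
        (hF.trans_le (Finset.card_le_card (hX.subset_thicken s F)))
      have h₃ : ((hX.thicken r (hX.thicken s F)).card : ℝ) ≤ (hX.thicken (r + s) F).card := by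
        exact_mod_cast Finset.card_le_card (hX.thicken_thicken_subset r s F)
      calc (1 + ε) ^ (k + 1) * F.card = (1 + ε) * ((1 + ε) ^ k * F.card) := by ring
        _ ≤ (1 + ε) * (hX.thicken s F).card := by gcongr
        _ ≤ _ := h₂.trans h₃
  refine ⟨N, fun C => ?_⟩
  obtain ⟨k, hk⟩ := pow_unbounded_of_one_lt (C : ℝ) (show 1 < 1 + ε by linarith)
  obtain ⟨s, hs⟩ := key k
  refine ⟨s, fun F hF => ?_⟩
  have : (C : ℝ) * F.card ≤ (hX.thicken s F).card :=
    (mul_le_mul_of_nonneg_right hk.le (by positivity)).trans (hs F hF)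
  exact_mod_cast this

/-- The coarse component of a point: the set of points at finite distance. -/
def component (x : X) : Set X := {z | edist z x < ∞}

theorem component_subset {x y : X} (h : edist x y < ∞) : component x ⊆ component y :=
  fun z hz => (edist_triangle z x y).trans_lt (ENNReal.add_lt_top.2 ⟨hz, h⟩)

theorem component_congr {x y : X} (h : edist x y < ∞) : component x = component y :=
  (component_subset h).antisymm (component_subset (by rwa [edist_comm]))

theorem mem_component_self (x : X) : x ∈ component x := by simp [component]

variable (X) in
/-- The union of the infinite coarse components. -/
def infinitePart : Set X := {x | (component x).Infinite}

theorem mem_infinitePart_of_edist_lt {x y : X} (h : edist x y < ∞) (hx : x ∈ infinitePart X) :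
    y ∈ infinitePart X := by
  simpa only [infinitePart, Set.mem_ofPred_eq, component_congr h] using hx

/-- A finite union of finite components is invariant under thickening, so it cannot have more than
`N` points. -/
theorem IsLocallyFinite.finite_compl_infinitePart (hX : IsLocallyFinite X)
    (h : ¬ IsProperlyAmenable X) : (infinitePart X)ᶜ.Finite := by
  classical
  obtain ⟨N, hN⟩ := hX.exists_large_expansion h
  obtain ⟨r, hr⟩ := hN 2
  by_contra hinf
  obtain ⟨F, hF, hcard⟩ := Set.Infinite.exists_subset_card_eq hinf (N + 1)
  have hfin : (⋃ x ∈ F, component x).Finite :=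
    F.finite_toSet.biUnion fun x hx => Set.not_infinite.1 (hF hx)
  set U := hfin.toFinset
  have hFU : F ⊆ U := fun x hx => by
    simpa [U] using ⟨x, hx, mem_component_self x⟩
  have hU : hX.thicken r U ⊆ U := by
    intro z hz
    obtain ⟨y, hy, hzy⟩ := hX.mem_thicken.1 hz
    simp only [U, Set.Finite.mem_toFinset, Set.mem_iUnion, exists_prop] at hy ⊢
    obtain ⟨x, hx, hyx⟩ := hy
    exact ⟨x, hx, component_subset hyx (hzy.trans_lt ENNReal.coe_lt_top)⟩
  have h₁ := Finset.card_le_card hFU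
  have h₂ := Finset.card_le_card hU
  have h₃ := hr U (by omega)
  omega

theorem IsLocallyFinite.exists_lt_card_ball (hX : IsLocallyFinite X) (N : ℕ) {x : X}
    (hx : x ∈ infinitePart X) : ∃ r : ℝ≥0, N < (hX.ball r x).card := by
  obtain ⟨F, hF, hcard⟩ := Set.Infinite.exists_subset_card_eq hx (N + 1)
  refine ⟨F.sup fun z => (edist z x).toNNReal, ?_⟩
  rw [← Nat.succ_le_iff, Nat.succ_eq_add_one, ← hcard]
  refine Finset.card_le_card fun z hz => hX.mem_ball.2 ?_
  rw [← ENNReal.coe_toNNReal (hF hz).ne, ENNReal.coe_le_coe]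
  exact Finset.le_sup (f := fun z => (edist z x).toNNReal) hz

theorem IsLocallyFinite.ball_mono (hX : IsLocallyFinite X) {r s : ℝ≥0} (h : r ≤ s) (x : X) :
    hX.ball r x ⊆ hX.ball s x := fun _ hz =>
  hX.mem_ball.2 ((hX.mem_ball.1 hz).trans (ENNReal.coe_le_coe.2 h))

/-- Expansion by `M + 1` is impossible for a large set of points whose balls have at most `M`
elements, so only finitely many such points exist; for these the radius is enlarged individually. -/
theorem IsLocallyFinite.exists_uniform_lt_card_ball (hX : IsLocallyFinite X)
    (h : ¬ IsProperlyAmenable X) (M : ℕ) :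
    ∃ r : ℝ≥0, ∀ x ∈ infinitePart X, M < (hX.ball r x).card := by
  classical
  obtain ⟨N, hN⟩ := hX.exists_large_expansion h
  obtain ⟨r, hr⟩ := hN (M + 1)
  have hfin : {x | (hX.ball r x).card ≤ M}.Finite := by
    by_contra hinf
    obtain ⟨F, hF, hcard⟩ := Set.Infinite.exists_subset_card_eq hinf (N + 1)
    have h₁ := hr F (by omega)
    have h₂ : (hX.thicken r F).card ≤ F.card * M :=
      Finset.card_biUnion_le_card_mul _ _ _ fun x hx => hF hx
    rw [add_mul, mul_comm] at h₁
    omega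
  choose! s hs using fun x (hx : x ∈ infinitePart X) => hX.exists_lt_card_ball M hx
  refine ⟨max r (hfin.toFinset.sup s), fun x hx => ?_⟩
  by_cases hxr : (hX.ball r x).card ≤ M
  · refine (hs x hx).trans_le (Finset.card_le_card (hX.ball_mono ?_ x))
    exact le_max_of_le_right (Finset.le_sup (f := s) (by simpa using hxr))
  · exact (not_le.1 hxr).trans_le (Finset.card_le_card (hX.ball_mono (le_max_left _ _) x))

/-- A preliminary thickening by `s` lifts even a single point above the threshold `N`. -/
theorem IsLocallyFinite.exists_doubling (hX : IsLocallyFinite X)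
    (h : ¬ IsProperlyAmenable X) :
    ∃ r : ℝ≥0, ∀ F : Finset X, (F : Set X) ⊆ infinitePart X →
      2 * F.card ≤ (hX.thicken r F).card := by
  classical
  obtain ⟨N, hN⟩ := hX.exists_large_expansion h
  obtain ⟨r, hr⟩ := hN 2
  obtain ⟨s, hs⟩ := hX.exists_uniform_lt_card_ball h N
  refine ⟨r + s, fun F hF => ?_⟩
  rcases F.eq_empty_or_nonempty with rfl | ⟨x, hx⟩
  · simp
  have h₁ : N < (hX.thicken s F).card :=
    (hs x (hF hx)).trans_le (Finset.card_le_card (Finset.subset_biUnion_of_mem _ hx))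
  have h₂ := hr _ h₁
  have h₃ := Finset.card_le_card (hX.thicken_thicken_subset r s F)
  have h₄ := Finset.card_le_card (hX.subset_thicken s F)
  omega

/-- Doubling is exactly Hall's condition when both copies of `x` may choose any point of the
`r`-ball around `x`. -/
theorem IsLocallyFinite.exists_injective_of_not_isProperlyAmenable (hX : IsLocallyFinite X)
    (h : ¬ IsProperlyAmenable X) :
    ∃ r : ℝ≥0, ∃ f : infinitePart X × Bool → X, Function.Injective f ∧
      ∀ p, edist (f p) p.1 ≤ r := by
  classical
  obtain ⟨r, hr⟩ := hX.exists_doubling h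
  have := (Finset.all_card_le_biUnion_card_iff_exists_injective
    fun p : infinitePart X × Bool => hX.ball r (p.1 : X)).1 ?_
  · obtain ⟨f, hf, hfr⟩ := this
    exact ⟨r, f, hf, fun p => hX.mem_ball.1 (hfr p)⟩
  intro s
  set F : Finset X := s.image fun p => (p.1 : X)
  have hF : (F : Set X) ⊆ infinitePart X := by
    intro x hx
    obtain ⟨p, -, rfl⟩ := Finset.mem_image.1 hx
    exact p.1.2
  have h₁ : s.card ≤ (F ×ˢ (Finset.univ : Finset Bool)).card := by
    refine Finset.card_le_card_of_injOn (fun p => ((p.1 : X), p.2)) (fun p hp => ?_) ?_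
    · simp only [Finset.coe_product, Finset.coe_univ, Set.mem_prod, Set.mem_univ, and_true]
      exact Finset.mem_coe.2 (Finset.mem_image_of_mem _ hp)
    · rintro ⟨p, a⟩ - ⟨q, b⟩ - hpq
      simpa [Subtype.ext_iff] using hpq
  rw [Finset.card_product, Finset.card_univ, Fintype.card_bool, mul_comm] at h₁
  refine (h₁.trans (hr F hF)).trans (Finset.card_le_card fun z hz => ?_)
  obtain ⟨x, hx, hzx⟩ := hX.mem_thicken.1 hz
  obtain ⟨p, hp, rfl⟩ := Finset.mem_image.1 hx
  exact Finset.mem_biUnion.2 ⟨p, hp, hX.mem_ball.2 hzx⟩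

theorem IsProperlyAmenable.of_finite [Finite X] [Nonempty X] : IsProperlyAmenable X := by
  have := Fintype.ofFinite X
  intro R _ ε hε A
  refine ⟨Finset.univ, ⟨Finset.univ_nonempty, Set.toFinite _, ?_⟩, Finset.subset_univ _⟩
  have : rBoundary R ((Finset.univ : Finset X) : Set X) = ∅ := by
    ext x
    simp [rBoundary]
  rw [this]
  simpa using hε.le

theorem IsLocallyFinite.infinitePart_nonempty (hX : IsLocallyFinite X) [Nonempty X]
    (h : ¬ IsProperlyAmenable X) : (infinitePart X).Nonempty := by
  by_contra hne
  have hfin := hX.finite_compl_infinitePart h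
  rw [Set.not_nonempty_iff_eq_empty.1 hne, Set.compl_empty, Set.finite_univ_iff] at hfin
  exact h .of_finite

end MetricLemmas

end

end CoarseAmenability

namespace CoarseAmenability

open Module

noncomputable section

/-! ### Dimension counts and properly infinite quotients -/

section AlgebraLemmas

variable {K : Type*} [Field K] {A : Type*} [Ring A] [Algebra K A] {B : Type*} [Ring B]

/-- Algebraically, proper infiniteness amounts to a pair of isometries with orthogonal ranges. -/
theorem isProperlyInfinite_iff [Nontrivial B] :
    IsProperlyInfinite B ↔ ∃ x₁ y₁ x₂ y₂ : B,
      y₁ * x₁ = 1 ∧ y₂ * x₂ = 1 ∧ y₁ * x₂ = 0 ∧ y₂ * x₁ = 0 := by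
  constructor
  · rintro ⟨-, -, e₁, e₂, -, -, -, -, h₁₂, h₂₁, ⟨x₁, y₁, rfl, h₁⟩, ⟨y₂, x₂, h₂, rfl⟩⟩
    refine ⟨x₁, y₁, x₂, y₂, h₁.symm, h₂.symm, ?_, ?_⟩
    -- Inserting the units `y₁ * x₁` and `y₂ * x₂` exposes the product `e₁ * e₂ = 0`.
    · calc y₁ * x₂ = (y₁ * x₁) * y₁ * x₂ * (y₂ * x₂) := by rw [← h₁, ← h₂]; simp
        _ = y₁ * (x₁ * y₁ * (x₂ * y₂)) * x₂ := by simp only [mul_assoc]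
        _ = 0 := by rw [h₁₂]; simp
    · calc y₂ * x₁ = (y₂ * x₂) * y₂ * x₁ * (y₁ * x₁) := by rw [← h₁, ← h₂]; simp
        _ = y₂ * (x₂ * y₂ * (x₁ * y₁)) * x₁ := by simp only [mul_assoc]
        _ = 0 := by rw [h₂₁]; simp
  · rintro ⟨x₁, y₁, x₂, y₂, h₁, h₂, h₁₂, h₂₁⟩
    refine ⟨inferInstance, IsIdempotentElem.one, x₁ * y₁, x₂ * y₂, ⟨x₁ * y₁, by simp⟩,
      ⟨x₂ * y₂, by simp⟩, ?_, ?_, ?_, ?_, ⟨x₁, y₁, rfl, h₁.symm⟩, ⟨y₂, x₂, h₂.symm, rfl⟩⟩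
    · rw [IsIdempotentElem, mul_assoc, ← mul_assoc y₁, h₁, one_mul]
    · rw [IsIdempotentElem, mul_assoc, ← mul_assoc y₂, h₂, one_mul]
    · rw [mul_assoc, ← mul_assoc y₁, h₁₂, zero_mul, mul_zero]
    · rw [mul_assoc, ← mul_assoc y₂, h₂₁, zero_mul, mul_zero]

/-- The map `(a, b) ↦ x₁ * a + x₂ * b` is injective, since `y₁` and `y₂` recover the two
coordinates. -/
theorem two_mul_finrank_le [Algebra K B] {x₁ y₁ x₂ y₂ : B} (h₁ : y₁ * x₁ = 1)
    (h₂ : y₂ * x₂ = 1) (h₁₂ : y₁ * x₂ = 0) (h₂₁ : y₂ * x₁ = 0) (W U : Submodule K B)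
    [FiniteDimensional K W] [FiniteDimensional K U] (hx₁ : ∀ w ∈ W, x₁ * w ∈ U)
    (hx₂ : ∀ w ∈ W, x₂ * w ∈ U) : 2 * finrank K W ≤ finrank K U := by
  let f : W × W →ₗ[K] U :=
    LinearMap.coprod ((LinearMap.mulLeft K x₁).restrict hx₁) ((LinearMap.mulLeft K x₂).restrict hx₂)
  have hf : Function.Injective f := by
    rw [← LinearMap.ker_eq_bot, LinearMap.ker_eq_bot']
    rintro ⟨a, b⟩ hab
    have hab' : x₁ * (a : B) + x₂ * b = 0 := by
      exact congrArg Subtype.val hab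
    have ha : (a : B) = 0 := by
      have := congrArg (y₁ * ·) hab'
      simpa [mul_add, ← mul_assoc, h₁, h₁₂] using this
    have hb : (b : B) = 0 := by
      have := congrArg (y₂ * ·) hab'
      simpa [mul_add, ← mul_assoc, h₂, h₂₁] using this
    ext <;> simp [ha, hb]
  have := LinearMap.finrank_le_finrank_of_injective hf
  rw [finrank_prod] at this
  omega

theorem finrank_le_finrank_map_add {V V' : Type*} [AddCommGroup V] [Module K V]
    [AddCommGroup V'] [Module K V'] (f : V →ₗ[K] V') [FiniteDimensional K (LinearMap.ker f)]
    (W : Submodule K V) [FiniteDimensional K W] :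
    finrank K W ≤ finrank K (W.map f) + finrank K (LinearMap.ker f) := by
  have h := LinearMap.finrank_range_add_finrank_ker (f.domRestrict W)
  have h' : finrank K (LinearMap.ker (f.domRestrict W)) ≤ finrank K (LinearMap.ker f) := by
    refine LinearMap.finrank_le_finrank_of_injective
      (f := (W.subtype.restrict fun x hx => ?_ : LinearMap.ker (f.domRestrict W) →ₗ[K] _)) ?_
    · exact hx
    · intro a b hab
      exact Subtype.ext (Subtype.ext (congrArg Subtype.val hab :))
  rw [LinearMap.range_domRestrict] at h
  omega

/-- This lets the containment clause of proper algebraic amenability force Følner subspaces of large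
dimension. -/
theorem exists_finset_card_le_finrank (h : ¬ FiniteDimensional K A) (n : ℕ) :
    ∃ S : Finset A, ∀ W : Submodule K A, FiniteDimensional K W → (S : Set A) ⊆ W →
      n ≤ finrank K W := by
  have hn : (n : Cardinal) ≤ Module.rank K A := by
    refine (Cardinal.natCast_lt_aleph0.le).trans ?_
    by_contra! hlt
    exact h (Module.rank_lt_aleph0_iff.1 hlt)
  obtain ⟨S, hS, hli⟩ := exists_finset_linearIndependent_of_le_rank hn
  refine ⟨S, fun W _ hW => ?_⟩
  rw [← hS, ← finrank_span_finset_eq_card hli]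
  exact Submodule.finrank_mono (Submodule.span_le.2 hW)

theorem IsProperlyAlgebraicallyAmenable.not_isProperlyInfinite [Algebra K B]
    (hA : IsProperlyAlgebraicallyAmenable K A) (f : A →ₐ[K] B) (hf : Function.Surjective f)
    [FiniteDimensional K (LinearMap.ker f.toLinearMap)] : ¬ IsProperlyInfinite B := by
  classical
  intro hB
  have := hB.1
  obtain ⟨x₁, y₁, x₂, y₂, h₁, h₂, h₁₂, h₂₁⟩ := isProperlyInfinite_iff.1 hB
  have hinf : ¬ FiniteDimensional K A := by
    intro _
    have : FiniteDimensional K B := Module.Finite.of_surjective f.toLinearMap hf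
    have h := two_mul_finrank_le h₁ h₂ h₁₂ h₂₁ (⊤ : Submodule K B) ⊤ (by simp) (by simp)
    have : 0 < finrank K B := finrank_pos
    rw [finrank_top] at h
    omega
  set d := finrank K (LinearMap.ker f.toLinearMap)
  -- With `w = dim W` and `ε = 1/8`, doubling gives `2 * (w - d) ≤ dim (U₁ ⊔ U₂) ≤ (5/4) * w`, hence
  -- `3 * w ≤ 8 * d`, which `w ≥ 4 * d + 1` excludes.
  obtain ⟨S, hS⟩ := exists_finset_card_le_finrank hinf (4 * d + 1)
  obtain ⟨a₁, rfl⟩ := hf x₁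
  obtain ⟨a₂, rfl⟩ := hf x₂
  obtain ⟨W, ⟨-, hWfin, hW⟩, hSW⟩ := hA (1 / 8) (by norm_num) (insert a₁ (insert a₂ S))
  have hw : 4 * d + 1 ≤ finrank K W := hS W hWfin (subset_trans (by
    intro x hx
    simp only [Finset.coe_insert]
    exact Or.inr (Or.inr hx)) hSW)
  have hwpos : (0 : ℝ) < finrank K W := by exact_mod_cast (by omega)
  set U₁ := W.map (LinearMap.mulLeft K a₁) ⊔ W
  set U₂ := W.map (LinearMap.mulLeft K a₂) ⊔ W
  have hU₁ : (finrank K U₁ : ℝ) ≤ (1 + 1 / 8) * finrank K W :=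
    (div_le_iff₀ hwpos).1 (hW a₁ (by simp))
  have hU₂ : (finrank K U₂ : ℝ) ≤ (1 + 1 / 8) * finrank K W :=
    (div_le_iff₀ hwpos).1 (hW a₂ (by simp))
  have hsum := Submodule.finrank_sup_add_finrank_inf_eq U₁ U₂
  have hinf : finrank K W ≤ finrank K ↥(U₁ ⊓ U₂) :=
    Submodule.finrank_mono (le_inf le_sup_right le_sup_right)
  have hmap : finrank K ((U₁ ⊔ U₂).map f.toLinearMap) ≤ finrank K ↥(U₁ ⊔ U₂) :=
    Submodule.finrank_map_le _ _
  have hle := finrank_le_finrank_map_add f.toLinearMap W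
  have hdouble := two_mul_finrank_le h₁ h₂ h₁₂ h₂₁ (W.map f.toLinearMap)
    ((U₁ ⊔ U₂).map f.toLinearMap) (by
      rintro _ ⟨w, hw, rfl⟩
      exact ⟨a₁ * w, Submodule.mem_sup_left (Submodule.mem_sup_left ⟨w, hw, rfl⟩), by simp⟩) (by
      rintro _ ⟨w, hw, rfl⟩
      exact ⟨a₂ * w, Submodule.mem_sup_right (Submodule.mem_sup_left ⟨w, hw, rfl⟩), by simp⟩)
  have hnat : 3 * finrank K W ≤ finrank K U₁ + finrank K U₂ + 2 * d := by omega
  have hreal : 3 * (finrank K W : ℝ) ≤ finrank K U₁ + finrank K U₂ + 2 * d := by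
    exact_mod_cast hnat
  have hw' : 4 * (d : ℝ) + 1 ≤ finrank K W := by exact_mod_cast hw
  linarith

theorem IsFiniteDimensionalExtension.exists_algHom [Algebra K B]
    (h : IsFiniteDimensionalExtension K A B) :
    ∃ f : A →ₐ[K] B, Function.Surjective f ∧
      FiniteDimensional K (LinearMap.ker f.toLinearMap) := by
  obtain ⟨I, _, hI, ⟨e⟩⟩ := h
  refine ⟨e.toAlgHom.comp (Ideal.Quotient.mkₐ K I),
    e.surjective.comp (Ideal.Quotient.mkₐ_surjective K I), ?_⟩
  have : LinearMap.ker (e.toAlgHom.comp (Ideal.Quotient.mkₐ K I)).toLinearMap =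
      I.restrictScalars K := by
    ext x
    simp [Ideal.Quotient.eq_zero_iff_mem]
  rw [this]
  exact hI

theorem IsProperlyAlgebraicallyAmenable.of_finiteDimensional [FiniteDimensional K A]
    [Nontrivial A] : IsProperlyAlgebraicallyAmenable K A := by
  intro ε hε S
  refine ⟨⊤, ⟨top_ne_bot, inferInstance, fun a _ => ?_⟩, fun _ _ => trivial⟩
  rw [sup_top_eq, div_self]
  · linarith
  · rw [finrank_top]
    exact_mod_cast (finrank_pos (R := K) (M := A)).ne'

end AlgebraLemmas

end

end CoarseAmenability

namespace CoarseAmenability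

open scoped ENNReal NNReal
open Module

noncomputable section

/-! ### Finite propagation in the translation algebra -/

section TranslationAlgebraLemmas

variable {K : Type*} [Field K] {X : Type*} [EMetricSpace X]

theorem PartialTranslation.operator_single_of_mem (t : PartialTranslation X) {x : X}
    (h : x ∈ t.dom) :
    t.operator K (Finsupp.single x 1) = Finsupp.single (t.toEquiv ⟨x, h⟩ : X) 1 := by
  simp [PartialTranslation.operator, h]

theorem PartialTranslation.operator_single_of_notMem (t : PartialTranslation X) {x : X}
    (h : x ∉ t.dom) : t.operator K (Finsupp.single x 1) = 0 := by
  simp [PartialTranslation.operator, h]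

theorem PartialTranslation.operator_mem (t : PartialTranslation X) :
    t.operator K ∈ translationAlgebra K X :=
  Algebra.subset_adjoin ⟨t, rfl⟩

/-- The partial translation given by an injective map which moves points a bounded distance. -/
def PartialTranslation.ofInjective {Y : Set X} (f : Y → X) (hf : Function.Injective f)
    (r : ℝ≥0) (hr : ∀ x, edist (f x) x ≤ r) : PartialTranslation X where
  dom := Y
  ran := Set.range f
  toEquiv := Equiv.ofInjective f hf
  controlled := (iSup_le fun x => by
    rw [edist_comm]; exact hr x : _ ≤ (r : ℝ≥0∞)).trans_lt ENNReal.coe_lt_top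

/-- The inverse partial translation. -/
def PartialTranslation.symm (t : PartialTranslation X) : PartialTranslation X where
  dom := t.ran
  ran := t.dom
  toEquiv := t.toEquiv.symm
  controlled := (iSup_le fun x => by
    have := le_iSup (fun x : t.dom => edist (x : X) (t.toEquiv x : X)) (t.toEquiv.symm x)
    simpa [edist_comm] using this :
      _ ≤ ⨆ x : t.dom, edist (x : X) (t.toEquiv x : X)).trans_lt t.controlled

theorem End.apply_eq_sum {ι : Type*} (T : Module.End K (ι →₀ K)) (v : ι →₀ K) (z : ι) :
    T v z = v.sum fun w c => c * T (Finsupp.single w 1) z := by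
  conv_lhs => rw [← Finsupp.sum_single v]
  rw [Finsupp.sum, map_sum, Finsupp.finsetSum_apply]
  refine Finset.sum_congr rfl fun w _ => ?_
  rw [← mul_one (v w), ← smul_eq_mul, ← Finsupp.smul_single, map_smul]
  simp

theorem End.exists_of_apply_ne_zero {ι : Type*} (T : Module.End K (ι →₀ K)) {v : ι →₀ K} {z : ι}
    (h : T v z ≠ 0) : ∃ w, v w ≠ 0 ∧ T (Finsupp.single w 1) z ≠ 0 := by
  rw [End.apply_eq_sum] at h
  obtain ⟨w, -, hw⟩ := Finset.exists_ne_zero_of_sum_ne_zero h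
  exact ⟨w, left_ne_zero_of_mul hw, right_ne_zero_of_mul hw⟩

/-- Elements of the translation algebra have finite propagation. -/
theorem exists_propagation {T : Module.End K (X →₀ K)} (hT : T ∈ translationAlgebra K X) :
    ∃ r : ℝ≥0, ∀ x z, T (Finsupp.single x 1) z ≠ 0 → edist z x ≤ r := by
  induction hT using Algebra.adjoin_induction with
  | mem T hT =>
    obtain ⟨t, rfl⟩ := hT
    lift (⨆ x : t.dom, edist (x : X) (t.toEquiv x : X)) to ℝ≥0 using t.controlled.ne with r hr
    refine ⟨r, fun x z h => ?_⟩
    by_cases hx : x ∈ t.dom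
    · change t.operator K _ z ≠ 0 at h
      rw [t.operator_single_of_mem hx] at h
      obtain rfl : (t.toEquiv ⟨x, hx⟩ : X) = z := by
        by_contra hne
        exact h (Finsupp.single_eq_of_ne (Ne.symm hne))
      rw [edist_comm, hr]
      exact le_iSup (fun x : t.dom => edist (x : X) (t.toEquiv x : X)) ⟨x, hx⟩
    · exact absurd (by simp [t.operator_single_of_notMem hx]) h
  | algebraMap c =>
    refine ⟨0, fun x z h => ?_⟩
    obtain rfl : x = z := by
      by_contra hne
      exact h (by simp [Module.algebraMap_end_apply, Finsupp.single_eq_of_ne (Ne.symm hne)])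
    simp
  | add S T _ _ hS hT =>
    obtain ⟨r, hr⟩ := hS
    obtain ⟨s, hs⟩ := hT
    refine ⟨max r s, fun x z h => ?_⟩
    by_cases hz : S (Finsupp.single x 1) z = 0
    · refine (hs x z fun hz' => h ?_).trans (ENNReal.coe_le_coe.2 (le_max_right _ _))
      simp [hz, hz']
    · exact (hr x z hz).trans (ENNReal.coe_le_coe.2 (le_max_left _ _))
  | mul S T _ _ hS hT =>
    obtain ⟨r, hr⟩ := hS
    obtain ⟨s, hs⟩ := hT
    refine ⟨r + s, fun x z h => ?_⟩
    obtain ⟨w, hw, hwz⟩ := End.exists_of_apply_ne_zero S (show S (T _) z ≠ 0 from h)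
    push_cast
    exact (edist_triangle z w x).trans (add_le_add (hr w z hwz) (hs x w hw))

theorem exists_uniform_propagation (S : Finset (translationAlgebra K X)) :
    ∃ r : ℝ≥0, 0 < r ∧ ∀ a ∈ S, ∀ x z,
      (a : Module.End K (X →₀ K)) (Finsupp.single x 1) z ≠ 0 → edist z x ≤ r := by
  choose r hr using fun a : translationAlgebra K X => exists_propagation a.2
  -- The `1` keeps the radius positive, as proper amenability requires.
  refine ⟨max 1 (S.sup r), by positivity, fun a ha x z h => (hr a x z h).trans ?_⟩
  exact ENNReal.coe_le_coe.2 (le_max_of_le_right (Finset.le_sup ha))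

theorem ext_single {ι : Type*} {S T : Module.End K (ι →₀ K)}
    (h : ∀ x, S (Finsupp.single x 1) = T (Finsupp.single x 1)) : S = T := by
  ext x : 2
  exact h x

/-! ### Operators supported on a union of components -/

/-- The operators which vanish on `δ_x` for all `x` in an infinite component. -/
def finitePartIdeal (K : Type*) [Field K] (X : Type*) [EMetricSpace X] :
    Ideal (translationAlgebra K X) where
  carrier := {T | ∀ x ∈ infinitePart X, (T : Module.End K (X →₀ K)) (Finsupp.single x 1) = 0}
  zero_mem' := fun x _ => rfl
  add_mem' := fun {S T} hS hT x hx => by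
    change (S : Module.End K (X →₀ K)) _ + (T : Module.End K (X →₀ K)) _ = 0
    rw [hS x hx, hT x hx, add_zero]
  smul_mem' := fun S T hT x hx => by
    change (S : Module.End K (X →₀ K)) ((T : Module.End K (X →₀ K)) _) = 0
    rw [hT x hx, map_zero]

/-- By finite propagation `T δ_x` is supported in the component of `x`, so the infinite part is
preserved. -/
instance : (finitePartIdeal K X).IsTwoSided where
  mul_mem_of_left := fun {S} T hS x hx => by
    change (S : Module.End K (X →₀ K)) ((T : Module.End K (X →₀ K)) _) = 0
    ext z
    by_contra hne
    obtain ⟨w, hw, hwz⟩ := End.exists_of_apply_ne_zero _ hne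
    obtain ⟨r, hr⟩ := exists_propagation T.2
    have hwx := (hr x w hw).trans_lt ENNReal.coe_lt_top
    rw [edist_comm] at hwx
    exact hwz (by rw [hS w (mem_infinitePart_of_edist_lt hwx hx)]; rfl)

/-- Propagation also confines the rows to the finite complement, leaving a finite matrix. -/
theorem finiteDimensional_finitePartIdeal (h : (infinitePart X)ᶜ.Finite) :
    FiniteDimensional K ↥((finitePartIdeal K X).restrictScalars K) := by
  have := h.to_subtype
  let f : ↥((finitePartIdeal K X).restrictScalars K) →ₗ[K]
      (↥(infinitePart X)ᶜ → ↥(infinitePart X)ᶜ → K) :=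
    { toFun := fun T x z => ((T : translationAlgebra K X) : Module.End K (X →₀ K))
        (Finsupp.single (x : X) 1) z
      map_add' := fun S T => rfl
      map_smul' := fun c T => rfl }
  refine FiniteDimensional.of_injective f ((injective_iff_map_eq_zero f).2 fun T hT => ?_)
  refine Subtype.ext (Subtype.ext (ext_single fun x => ?_))
  change _ = (0 : X →₀ K)
  by_cases hx : x ∈ infinitePart X
  · exact T.2 x hx
  · ext z
    by_contra hne
    obtain ⟨r, hr⟩ := exists_propagation (T : translationAlgebra K X).2
    have hz : z ∉ infinitePart X := fun hz =>
      hx (mem_infinitePart_of_edist_lt ((hr x z hne).trans_lt ENNReal.coe_lt_top) hz)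
    exact hne (congrFun (congrFun hT ⟨x, hx⟩) ⟨z, hz⟩)

theorem isProperlyInfinite_quotient [Nonempty X] (hX : IsLocallyFinite X)
    (h : ¬ IsProperlyAmenable X) :
    IsProperlyInfinite (translationAlgebra K X ⧸ finitePartIdeal K X) := by
  obtain ⟨r, f, hf, hfr⟩ := hX.exists_injective_of_not_isProperlyAmenable h
  let t (b : Bool) : PartialTranslation X :=
    PartialTranslation.ofInjective (fun x : infinitePart X => f (x, b))
      (fun x y hxy => by simpa using hf hxy) r fun x => hfr (x, b)
  let V (b : Bool) : translationAlgebra K X := ⟨(t b).operator K, (t b).operator_mem⟩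
  let V' (b : Bool) : translationAlgebra K X := ⟨(t b).symm.operator K, (t b).symm.operator_mem⟩
  have hV (b : Bool) (x : infinitePart X) :
      (t b).operator K (Finsupp.single (x : X) 1) = Finsupp.single (f (x, b)) 1 :=
    (t b).operator_single_of_mem x.2
  have h_same (b : Bool) : V' b * V b - 1 ∈ finitePartIdeal K X := by
    intro x hx
    change (t b).symm.operator K ((t b).operator K (Finsupp.single x 1)) - Finsupp.single x 1 = 0
    rw [hV b ⟨x, hx⟩, (t b).symm.operator_single_of_mem (⟨⟨x, hx⟩, rfl⟩ : _ ∈ (t b).ran)]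
    have : ((t b).symm.toEquiv ⟨f (⟨x, hx⟩, b), ⟨⟨x, hx⟩, rfl⟩⟩ : infinitePart X) = ⟨x, hx⟩ :=
      (t b).toEquiv.symm_apply_apply ⟨x, hx⟩
    rw [show ((t b).symm.toEquiv ⟨f (⟨x, hx⟩, b), ⟨⟨x, hx⟩, rfl⟩⟩ : X) = x from
      congrArg Subtype.val this, sub_self]
  have h_diff (b c : Bool) (hbc : b ≠ c) : V' b * V c - 0 ∈ finitePartIdeal K X := by
    rw [sub_zero]
    intro x hx
    change (t b).symm.operator K ((t c).operator K (Finsupp.single x 1)) = 0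
    rw [hV c ⟨x, hx⟩, (t b).symm.operator_single_of_notMem]
    rintro ⟨y, hy⟩
    exact hbc (congrArg Prod.snd (hf hy))
  have : Nontrivial (translationAlgebra K X ⧸ finitePartIdeal K X) := by
    refine Ideal.Quotient.nontrivial_iff.2 fun htop => ?_
    obtain ⟨x, hx⟩ := hX.infinitePart_nonempty h
    have := (Ideal.eq_top_iff_one _).1 htop x hx
    exact one_ne_zero (Finsupp.single_eq_zero.1 (show Finsupp.single x (1 : K) = 0 from this))
  refine isProperlyInfinite_iff.2 ⟨Ideal.Quotient.mk _ (V true), Ideal.Quotient.mk _ (V' true),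
    Ideal.Quotient.mk _ (V false), Ideal.Quotient.mk _ (V' false), ?_, ?_, ?_, ?_⟩
  · exact Ideal.Quotient.eq.2 (h_same true)
  · exact Ideal.Quotient.eq.2 (h_same false)
  · exact Ideal.Quotient.eq.2 (h_diff true false (by simp))
  · exact Ideal.Quotient.eq.2 (h_diff false true (by simp))

/-! ### A copy of the permutation module inside the translation algebra -/

theorem component_nonempty (x : X) : (component x).Nonempty := ⟨x, mem_component_self x⟩

/-- A chosen base point in the component of `x`. -/
def basePoint (x : X) : X := (component_nonempty x).some

theorem edist_basePoint_lt (x : X) : edist (basePoint x) x < ∞ := (component_nonempty x).some_mem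

theorem basePoint_congr {x y : X} (h : edist x y < ∞) : basePoint x = basePoint y := by
  simp only [basePoint, component_congr h]

/-- The matrix unit sending the base point of the component of `x` to `x`. -/
def basePointUnit (K : Type*) [Field K] (x : X) : translationAlgebra K X :=
  ⟨(PartialTranslation.ofInjective (Y := {basePoint x}) (fun _ => x)
    (fun a b _ => Subsingleton.elim a b) (edist (basePoint x) x).toNNReal (by
      rintro ⟨_, rfl⟩
      rw [ENNReal.coe_toNNReal (edist_basePoint_lt x).ne, edist_comm])).operator K,
    PartialTranslation.operator_mem _⟩

theorem basePointUnit_apply_self (x : X) :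
    (basePointUnit K x : Module.End K (X →₀ K)) (Finsupp.single (basePoint x) 1) =
      Finsupp.single x 1 :=
  PartialTranslation.operator_single_of_mem _ rfl

theorem basePointUnit_apply_of_ne {x w : X} (h : w ≠ basePoint x) :
    (basePointUnit K x : Module.End K (X →₀ K)) (Finsupp.single w 1) = 0 :=
  PartialTranslation.operator_single_of_notMem _ h

/-- The embedding of `K[X]` as a left module into the translation algebra. -/
def columnEmbedding (K : Type*) [Field K] (X : Type*) [EMetricSpace X] :
    (X →₀ K) →ₗ[K] translationAlgebra K X :=
  Finsupp.linearCombination K (basePointUnit K)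

open Classical in
-- Each component uses its own column: a matrix unit joining different components has infinite
-- propagation, so one column would not suffice.
theorem columnEmbedding_apply_single (v : X →₀ K) (w : X) :
    (columnEmbedding K X v : Module.End K (X →₀ K)) (Finsupp.single w 1) =
      v.filter fun z => basePoint z = w := by
  induction v using Finsupp.induction_linear with
  | zero => rw [map_zero, Finsupp.filter_zero]; rfl
  | add u v hu hv =>
    rw [map_add, Finsupp.filter_add, ← hu, ← hv]
    rfl
  | single x c =>
    rw [columnEmbedding, Finsupp.linearCombination_single]
    change c • (basePointUnit K x : Module.End K (X →₀ K)) _ = _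
    by_cases hw : basePoint x = w
    · rw [Finsupp.filter_single_of_pos (fun z => basePoint z = w) hw, ← hw, basePointUnit_apply_self]
      simp
    · rw [Finsupp.filter_single_of_neg (fun z => basePoint z = w) hw, basePointUnit_apply_of_ne (Ne.symm hw), smul_zero]

theorem columnEmbedding_injective : Function.Injective (columnEmbedding K X) := by
  classical
  refine (injective_iff_map_eq_zero _).2 fun v hv => ?_
  ext z
  have h := columnEmbedding_apply_single v (basePoint z)
  rw [hv] at h
  have := DFunLike.congr_fun h z
  rw [Finsupp.filter_apply_pos (fun y => basePoint y = basePoint z) _ rfl] at this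
  exact this.symm

/-- Elements of the algebra preserve components, hence commute with restriction to the points
sharing a given base point. -/
theorem mul_columnEmbedding (a : translationAlgebra K X) (v : X →₀ K) :
    a * columnEmbedding K X v = columnEmbedding K X ((a : Module.End K (X →₀ K)) v) := by
  classical
  refine Subtype.ext (ext_single fun w => ?_)
  change (a : Module.End K (X →₀ K)) ((columnEmbedding K X v : Module.End K (X →₀ K)) _) = _
  rw [columnEmbedding_apply_single, columnEmbedding_apply_single]
  obtain ⟨r, hr⟩ := exists_propagation a.2
  induction v using Finsupp.induction_linear with
  | zero => rw [map_zero, Finsupp.filter_zero, map_zero]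
  | add u v hu hv => rw [map_add, Finsupp.filter_add, Finsupp.filter_add, map_add, hu, hv]
  | single x c =>
    rw [← mul_one c, ← smul_eq_mul, ← Finsupp.smul_single, map_smul, Finsupp.filter_smul,
      Finsupp.filter_smul, map_smul]
    congr 1
    have hbase : ∀ z, (a : Module.End K (X →₀ K)) (Finsupp.single x 1) z ≠ 0 →
        basePoint z = basePoint x := fun z hz =>
      basePoint_congr ((hr x z hz).trans_lt ENNReal.coe_lt_top)
    by_cases hw : basePoint x = w
    · rw [Finsupp.filter_single_of_pos (fun z => basePoint z = w) hw, eq_comm, Finsupp.filter_eq_self_iff]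
      exact fun z hz => (hbase z hz).trans hw
    · rw [Finsupp.filter_single_of_neg (fun z => basePoint z = w) hw, map_zero, eq_comm, Finsupp.filter_eq_zero_iff]
      intro z hz
      by_contra hne
      exact hw ((hbase z hne).symm.trans hz)

theorem finrank_map_supported {ι : Type*} {V : Type*} [AddCommGroup V] [Module K V] (f : (ι →₀ K) →ₗ[K] V)
    (hf : Function.Injective f) (F : Finset ι) :
    finrank K ((Finsupp.supported K K (F : Set ι)).map f) = F.card := by
  rw [← (Submodule.equivMapOfInjective f hf _).finrank_eq,
    (Finsupp.supportedEquivFinsupp (F : Set ι)).finrank_eq, Module.finrank_finsupp_self]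
  simp

instance finiteDimensional_supported (F : Finset ι) :
    FiniteDimensional K (Finsupp.supported K K (F : Set ι)) :=
  Module.Finite.equiv (Finsupp.supportedEquivFinsupp (F : Set ι)).symm

/-- Any point reached outside `F` is within `r` of `F` and lies in the complement, hence in the
boundary. -/
theorem map_mem_supported {T : Module.End K (X →₀ K)} {r : ℝ≥0}
    (hT : ∀ x z, T (Finsupp.single x 1) z ≠ 0 → edist z x ≤ r) {F B : Finset X}
    (hB : rBoundary (r : ℝ) (F : Set X) ⊆ B) [DecidableEq X] {v : X →₀ K}
    (hv : v ∈ Finsupp.supported K K (F : Set X)) :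
    T v ∈ Finsupp.supported K K ((F ∪ B : Finset X) : Set X) := by
  rw [Finsupp.mem_supported] at hv ⊢
  intro z hz
  obtain ⟨x, hx, hxz⟩ := End.exists_of_apply_ne_zero T (Finsupp.mem_support_iff.1 hz)
  rw [Finset.coe_union]
  by_cases hzF : z ∈ (F : Set X)
  · exact Or.inl hzF
  · exact Or.inr (hB (mem_rBoundary_of_edist_le (hv (Finsupp.mem_support_iff.2 hx)) hzF
      (hT x z hxz)))

theorem IsProperlyAmenable.isProperlyAlgebraicallyAmenable_of_infinite [Infinite X]
    (h : IsProperlyAmenable X) :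
    IsProperlyAlgebraicallyAmenable K (translationAlgebra K X) := by
  classical
  intro ε hε S
  obtain ⟨r, hr0, hr⟩ := exists_uniform_propagation S
  -- Containing `A₀` makes `F` so large that `P` and `a P`, of total dimension at most `2 * |S|`,
  -- cost at most `(ε / 2) * |F|`; the boundary takes the other half of `ε`.
  obtain ⟨A₀, hA₀⟩ := Infinite.exists_subset_card_eq X (⌈4 * (S.card : ℝ) / ε⌉₊ + 1)
  obtain ⟨F, ⟨hF0, hfin, hF⟩, hA₀F⟩ := h r (by exact_mod_cast hr0) (ε / 2) (by positivity) A₀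
  have hFpos : (0 : ℝ) < F.card := by exact_mod_cast hF0.card_pos
  rw [div_le_iff₀ hFpos] at hF
  set B := hfin.toFinset
  have hB : rBoundary (r : ℝ) (F : Set X) ⊆ B := by simp [B]
  rw [Set.ncard_eq_toFinset_card _ hfin] at hF
  have hSF : 4 * (S.card : ℝ) ≤ ε * F.card := by
    have h₁ : (⌈4 * (S.card : ℝ) / ε⌉₊ : ℝ) ≤ F.card := by
      exact Nat.cast_le.2 (by have := Finset.card_le_card hA₀F; omega)
    have h₂ := (Nat.le_ceil _).trans h₁
    rw [div_le_iff₀ hε] at h₂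
    linarith
  let φ := columnEmbedding K X
  let W₀ := (Finsupp.supported K K (F : Set X)).map φ
  let W₁ := (Finsupp.supported K K ((F ∪ B : Finset X) : Set X)).map φ
  let P : Submodule K (translationAlgebra K X) := Submodule.span K (S : Set _)
  have hP : finrank K P ≤ S.card := finrank_span_finset_le_card S
  have hW₀ : finrank K W₀ = F.card := finrank_map_supported φ columnEmbedding_injective F
  have hW₁ : finrank K W₁ = (F ∪ B).card := finrank_map_supported φ columnEmbedding_injective _
  have hW₀₁ : W₀ ≤ W₁ := Submodule.map_mono (Finsupp.supported_mono (by simp))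
  have hFW : F.card ≤ finrank K ↥(W₀ ⊔ P) := hW₀ ▸ Submodule.finrank_mono le_sup_left
  refine ⟨W₀ ⊔ P, ⟨?_, inferInstance, fun a ha => ?_⟩, fun x hx =>
    Submodule.mem_sup_right (Submodule.subset_span hx)⟩
  · rintro hbot
    rw [hbot, finrank_bot] at hFW
    exact hF0.card_pos.not_ge hFW
  · have hle : (W₀ ⊔ P).map (LinearMap.mulLeft K a) ⊔ (W₀ ⊔ P) ≤
        W₁ ⊔ (P.map (LinearMap.mulLeft K a) ⊔ P) := by
      rw [Submodule.map_sup]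
      refine sup_le (sup_le ?_ ?_) (sup_le ?_ ?_)
      · refine le_sup_of_le_left ?_
        rintro _ ⟨_, ⟨v, hv, rfl⟩, rfl⟩
        refine ⟨_, map_mem_supported (hr a ha) hB hv, ?_⟩
        exact (mul_columnEmbedding a v).symm
      · exact le_sup_of_le_right le_sup_left
      · exact le_sup_of_le_left hW₀₁
      · exact le_sup_of_le_right le_sup_right
    have h₁ := Submodule.finrank_mono hle
    have h₂ := Submodule.finrank_add_le_finrank_add_finrank W₁ (P.map (LinearMap.mulLeft K a) ⊔ P)
    have h₃ := Submodule.finrank_add_le_finrank_add_finrank (P.map (LinearMap.mulLeft K a)) P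
    have h₄ := Submodule.finrank_map_le (LinearMap.mulLeft K a) P
    have h₅ := Finset.card_union_le F B
    have h₆ : finrank K ↥((W₀ ⊔ P).map (LinearMap.mulLeft K a) ⊔ (W₀ ⊔ P)) ≤
        F.card + B.card + 2 * S.card := by omega
    have h₇ : (finrank K ↥((W₀ ⊔ P).map (LinearMap.mulLeft K a) ⊔ (W₀ ⊔ P)) : ℝ) ≤
        F.card + B.card + 2 * S.card := by exact_mod_cast h₆
    have hFW' : (F.card : ℝ) ≤ finrank K ↥(W₀ ⊔ P) := by exact_mod_cast hFW
    rw [div_le_iff₀ (hFpos.trans_le hFW')]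
    have : (1 + ε) * (F.card : ℝ) ≤ (1 + ε) * finrank K ↥(W₀ ⊔ P) := by gcongr
    linarith

theorem IsProperlyAmenable.isProperlyAlgebraicallyAmenable [Nonempty X]
    (h : IsProperlyAmenable X) :
    IsProperlyAlgebraicallyAmenable K (translationAlgebra K X) := by
  rcases finite_or_infinite X with hfin | hinf
  · have : FiniteDimensional K (translationAlgebra K X) :=
      FiniteDimensional.of_injective (V₂ := Module.End K (X →₀ K))
        { toFun := Subtype.val, map_add' := fun _ _ => rfl, map_smul' := fun _ _ => rfl }
        Subtype.val_injective
    have : Nontrivial (translationAlgebra K X) := by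
      obtain ⟨x⟩ := ‹Nonempty X›
      refine ⟨basePointUnit K x, 0, fun h0 => ?_⟩
      have h1 := basePointUnit_apply_self (K := K) x
      rw [h0] at h1
      exact one_ne_zero (Finsupp.single_eq_zero.1 (show Finsupp.single x (1 : K) = 0 from h1.symm))
    exact .of_finiteDimensional
  · exact h.isProperlyAlgebraicallyAmenable_of_infinite

end TranslationAlgebraLemmas

end

end CoarseAmenability

theorem theorem6p4 (K : Type u) [Field K] (X : Type v) [EMetricSpace X] [Nonempty X]
    (hX : CoarseAmenability.IsLocallyFinite X) :
    List.TFAE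
      [CoarseAmenability.IsProperlyAmenable X,
        CoarseAmenability.IsProperlyAlgebraicallyAmenable K
          (CoarseAmenability.translationAlgebra K X),
        ¬ ∃ (B : Type (max u v)) (_ : Ring B) (_ : Algebra K B),
          CoarseAmenability.IsProperlyInfinite B ∧
            CoarseAmenability.IsFiniteDimensionalExtension K
              (CoarseAmenability.translationAlgebra K X) B] := by
  tfae_have 1 → 2 := fun h => h.isProperlyAlgebraicallyAmenable
  tfae_have 2 → 3 := by
    rintro h ⟨B, _, _, hB, hext⟩
    obtain ⟨f, hf, _⟩ := hext.exists_algHom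
    exact h.not_isProperlyInfinite f hf hB
  tfae_have 3 → 1 := by
    contrapose!
    intro h
    -- The forbidden algebra is the quotient by `finitePartIdeal` itself.
    exact ⟨_, inferInstance, inferInstance, CoarseAmenability.isProperlyInfinite_quotient hX h,
      CoarseAmenability.finitePartIdeal K X, inferInstance,
      CoarseAmenability.finiteDimensional_finitePartIdeal (hX.finite_compl_infinitePart h),
      ⟨AlgEquiv.refl⟩⟩
  tfae_finish
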